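/- **Setting.** Let $p\ge 2$, let $z^{\mathrm r}\in\mathbb R^p$ have positive components, and let $Z=\{z: 0<z_j<z^{\mathrm r}_j,\ j=1,\dots,p\}$. For $a,b\in\mathbb R^p$, $a$ *dominates* $b$ if $a_j\le b_j$ for all $j$ and $a\ne b$; $a$ *strictly dominates* $b$, written $a<b$, if $a_j<b_j$ for all $j$. A set is *stable* if none of its points dominates another. For $N\subset Z$ let $D(N)=\{x: z_j\le x_j\le z^{\mathrm r}_j \text{ for all } j,\text{ for some } z\in N\}$, let the hypervolume $V(N)$ be the Lebesgue measure of $D(N)$, and let $U(N)$ be the set of those $u\in[0,z^{\mathrm r}]$ that are maximal (for dominance) with the property that $[0,u)=\{x: 0\le x_j<u_j \text{ for all } j\}$ contains no point of $N$. For vectors $z,u$, $(z_j,u_{-j})$ is $u$ with its $j$-th component replaced by $z_j$. **Algorithms.** A *local upper bound* is stored as a vector $u$ together with $p$ defining points $z^1(u),\dots,z^p(u)$; stored items with the same vector and different defining points are distinct. Start with $S=\{z^{\mathrm r}\}$, where $z^k(z^{\mathrm r})=(z^{\mathrm r}_k,0_{-k})$ is the $k$-th dummy point. To insert a point $\bar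 z$, let $A=\{u\in S:\bar z<u\}$. * *HBDA-I (incremental)* replaces $S$ by $(S\setminus A)\cup\{(\bar z_j,u_{-j}): u\in A,\ 1\le j\le p,\ \bar z_j\ge\max_{k\ne j}z^k_j(u)\}$. * *HBDA-NI (nonincremental)* replaces $S$ by $(S\setminus A)\cup\{(\bar z_p,u_{-p}):u\in A\}\cup\{(\bar z_j,u_{-j}): u\in A,\ 1\le j\le p-1,\ \bar z_j\ge\max_{k\ne j}z^k_j(u)\}$. In both, $(\bar z_j,u_{-j})$ gets $\bar z$ as $j$-th defining point and keeps $z^k(u)$ for $k\ne j$. With each $u\in S$ is associated the box $$B(u)=[z^1_1(u),z^{\mathrm r}_1]\times\prod_{j=2}^p\Big[\max_{k<j}z^k_j(u),\,u_j\Big),$$ and the algorithm returns the sum over $u\in S$ of the products of the side lengths of $B(u)$. **Proposition.** Let $N=\{z^1,\dots,z^n\}\subset Z$ be any finite stable set of $n\ge 0$ distinct points. The points need not be in general position: distinct points may share component values. Let $S$ be the result of HBDA-I after inserting $z^1,\dots,z^n$ in this order, or, if $z^1_p\le z^2_p\le\dots\le z^n_p$ (ties allowed), the result of HBDA-NI.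 For $a,b\in N\cup\{\text{dummy points}\}$ write $a<_j b$ if $a_j<b_j$, or if $a_j=b_j$, $a=z^{i_1}$, $b=z^{i_2}$ and $i_1<i_2$. Then: 1. The tests agree with tie-breaking by index. For every inserted point $\bar z$ and every local upper bound $u$ stored just before its insertion, $\bar z<u$ if and only if $\bar z<_j z^j(u)$ for all $j$; and, for every $j$, $\bar z_j\ge\max_{k\ne j}z^k_j(u)$ if and only if $z^k(u)<_j\bar z$ for all $k\ne j$. 2. $U(N)$ is exactly the set of maximal elements, for dominance, of the set of vectors $u$ in $S$. Moreover, for every $u\in S$ and every $j$: $z^j(u)$ is a point of $N$ or the $j$-th dummy point, $z^j_j(u)=u_j$, and $z^j(u)<_k z^k(u)$ for every $k\ne j$. 3. The boxes $B(u)$, $u\in S$, have nonnegative side lengths, are pairwise disjoint, and a point $x<z^{\mathrm r}$ lies in one of them if and only if $x\in D(N)$. (So, up to a set of measure zero, they partition $D(N)$.) 4. The number returned is exactly $V(N)$. -/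

import Mathlib

namespace HBDA

/-- `a` strictly dominates `b` : `a_j < b_j` for every component `j`. -/
def StrictlyDominates {p : ℕ} (a b : Fin p → ℝ) : Prop := ∀ j, a j < b j

/-- `a` dominates `b` : `a_j ≤ b_j` for every component `j`, and `a ≠ b`. -/
def Dominates {p : ℕ} (a b : Fin p → ℝ) : Prop := (∀ j, a j ≤ b j) ∧ a ≠ b

/-- A set of points is stable if none of its points dominates another one. -/
def Stable {p : ℕ} (N : Set (Fin p → ℝ)) : Prop := ∀ a ∈ N, ∀ b ∈ N, ¬ Dominates a b

/-- The dominated region `D(N)` with respect to the reference point `zr`. -/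
def dominatedRegion {p : ℕ} (zr : Fin p → ℝ) (N : Set (Fin p → ℝ)) : Set (Fin p → ℝ) :=
  {x | ∃ z ∈ N, (∀ j, z j ≤ x j) ∧ ∀ j, x j ≤ zr j}

/-- The hypervolume `V(N)` : the Lebesgue measure of the dominated region. -/
noncomputable def hypervolume {p : ℕ} (zr : Fin p → ℝ) (N : Set (Fin p → ℝ)) : ℝ :=
  (MeasureTheory.volume (dominatedRegion zr N)).toReal

/-- `[0, u)` does not contain any point of `N`. -/
def EmptyBelow {p : ℕ} (N : Set (Fin p → ℝ)) (u : Fin p → ℝ) : Prop :=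
  ∀ z ∈ N, ¬ ((∀ j, 0 ≤ z j) ∧ StrictlyDominates z u)

/-- The upper bound set `U(N)` : the points `u` of `[0, zr]` that are maximal, for the dominance
relation, with the property that `[0, u)` contains no point of `N`. -/
def upperBoundSet {p : ℕ} (zr : Fin p → ℝ) (N : Set (Fin p → ℝ)) : Set (Fin p → ℝ) :=
  {u | u ∈ Set.Icc 0 zr ∧ EmptyBelow N u ∧
    ∀ v ∈ Set.Icc 0 zr, Dominates u v → ¬ EmptyBelow N v}

/-- A local upper bound `u` as it is stored by the algorithms: the vector `u` together with the
defining points `z^1(u), …, z^p(u)` that are tracked for it. -/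
@[ext]
structure LocalUpperBound (p : ℕ) where
  /-- The vector `u`. -/
  pt : Fin p → ℝ
  /-- The defining points: `defPt k` is `z^k(u)`. -/
  defPt : Fin p → Fin p → ℝ

/-- The dummy point with `j`-th component `zr j` and all other components zero. -/
noncomputable def dummy {p : ℕ} (zr : Fin p → ℝ) (j : Fin p) : Fin p → ℝ :=
  Function.update 0 j (zr j)

/-- The initial local upper bound `zr`, defined by the dummy points. -/
noncomputable def initial {p : ℕ} (zr : Fin p → ℝ) : LocalUpperBound p := ⟨zr, dummy zr⟩

/-- The vector `(z_j, u_{-j})`, with defining points `z` for component `j` and those of `u` for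
the other components. -/
noncomputable def LocalUpperBound.child {p : ℕ} (u : LocalUpperBound p) (z : Fin p → ℝ)
    (j : Fin p) : LocalUpperBound p :=
  ⟨Function.update u.pt j (z j), Function.update u.defPt j z⟩

/-- The test `z_j ≥ max_{k ≠ j} z_j^k(u)`. -/
def Accepts {p : ℕ} (z : Fin p → ℝ) (u : LocalUpperBound p) (j : Fin p) : Prop :=
  ∀ k, k ≠ j → z j ≥ u.defPt k j

open Classical in
/-- One insertion of the point `z` in the incremental algorithm. -/
noncomputable def insertI {p : ℕ} (S : Finset (LocalUpperBound p)) (z : Fin p → ℝ) :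
    Finset (LocalUpperBound p) :=
  let A := S.filter fun u => StrictlyDominates z u.pt
  ((A ×ˢ (Finset.univ : Finset (Fin p))).filter fun q => Accepts z q.1 q.2).image
      (fun q => q.1.child z q.2)
    ∪ (S \ A)

open Classical in
/-- One insertion of the point `z` in the nonincremental algorithm; the component with
`j + 1 = p` is the last one, and it is not tested. -/
noncomputable def insertNI {p : ℕ} (S : Finset (LocalUpperBound p)) (z : Fin p → ℝ) :
    Finset (LocalUpperBound p) :=
  let A := S.filter fun u => StrictlyDominates z u.pt
  ((A ×ˢ (Finset.univ : Finset (Fin p))).filter fun q => q.2.val + 1 = p).image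
      (fun q => q.1.child z q.2)
    ∪ ((A ×ˢ (Finset.univ : Finset (Fin p))).filter
        fun q => q.2.val + 1 < p ∧ Accepts z q.1 q.2).image (fun q => q.1.child z q.2)
    ∪ (S \ A)

/-- The incremental algorithm, run on the points of the list `l` in the order of the list. -/
noncomputable def ubsI {p : ℕ} (zr : Fin p → ℝ) (l : List (Fin p → ℝ)) :
    Finset (LocalUpperBound p) :=
  l.foldl insertI {initial zr}

/-- The nonincremental algorithm, run on the points of the list `l` in the order of the list. -/
noncomputable def ubsNI {p : ℕ} (zr : Fin p → ℝ) (l : List (Fin p → ℝ)) :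
    Finset (LocalUpperBound p) :=
  l.foldl insertNI {initial zr}

/-- The lower corner of `B(u)` : `z^1_1(u)` in the first component, and
`max_{k < j} z^k_j(u)` in every other component `j`. -/
noncomputable def LocalUpperBound.lower {p : ℕ} (u : LocalUpperBound p) (j : Fin p) : ℝ :=
  if h : j.val = 0 then u.defPt j j
  else (Finset.univ.filter fun k : Fin p => k < j).sup'
    ⟨⟨0, j.pos⟩, Finset.mem_filter.2 ⟨Finset.mem_univ _, Nat.pos_of_ne_zero h⟩⟩
    (fun k => u.defPt k j)

/-- The upper corner of `B(u)` : `zr_1` in the first component and `u_j` in the others. -/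
noncomputable def LocalUpperBound.upper {p : ℕ} (zr : Fin p → ℝ) (u : LocalUpperBound p)
    (j : Fin p) : ℝ :=
  if j.val = 0 then zr j else u.pt j

/-- The box `B(u)`, closed in the first component, half-open in the others. -/
def LocalUpperBound.box {p : ℕ} (zr : Fin p → ℝ) (u : LocalUpperBound p) : Set (Fin p → ℝ) :=
  {x | ∀ j, u.lower j ≤ x j ∧ if j.val = 0 then x j ≤ u.upper zr j else x j < u.upper zr j}

/-- The number returned by the box decomposition algorithm with the local upper bounds `S` : the
sum over `S` of the products of the side lengths of `B(u)`. -/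
noncomputable def boxVolumeSum {p : ℕ} (zr : Fin p → ℝ) (S : Finset (LocalUpperBound p)) : ℝ :=
  ∑ u ∈ S, ∏ j, (u.upper zr j - u.lower j)

/-- The total order on `j`-th components with ties broken by the index in the list `l` : the
`j`-th component of `a` is smaller than that of `b`, or they are equal and `a` is listed
before `b`. -/
def TieLT {p : ℕ} (l : List (Fin p → ℝ)) (j : Fin p) (a b : Fin p → ℝ) : Prop :=
  a j < b j ∨ (a j = b j ∧ List.Sublist [a, b] l)

/-- In the run of the algorithm `ubs` on `l`, whenever a point `z` is inserted and a current local
upper bound `u` is tested, the tests on real numbers have the same result as the tests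
with ties broken by the index. -/
def TestsAgree {p : ℕ} (ubs : List (Fin p → ℝ) → Finset (LocalUpperBound p))
    (l : List (Fin p → ℝ)) : Prop :=
  ∀ l₁ z l₂, l = l₁ ++ z :: l₂ → ∀ u ∈ ubs l₁,
    (StrictlyDominates z u.pt ↔ ∀ j, TieLT l j z (u.defPt j)) ∧
    ∀ j, (Accepts z u j ↔ ∀ k, k ≠ j → TieLT l j (u.defPt k) z)

/-- The finite set `S` of local upper bounds is a correct result for the points of `l`. -/
structure IsValid {p : ℕ} (zr : Fin p → ℝ) (l : List (Fin p → ℝ))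
    (S : Finset (LocalUpperBound p)) : Prop where
  /-- The maximal vectors among the computed ones are exactly the elements of `U(N)`. -/
  maximal_eq : upperBoundSet zr {z | z ∈ l} =
    {u | (∃ r ∈ S, r.pt = u) ∧ ∀ r ∈ S, ¬ Dominates u r.pt}
  /-- The `j`-th defining point is an input point or the `j`-th dummy point. -/
  defPt_mem : ∀ u ∈ S, ∀ j, u.defPt j ∈ l ∨ u.defPt j = dummy zr j
  /-- The `j`-th defining point gives the `j`-th component of `u`. -/
  defPt_self : ∀ u ∈ S, ∀ j, u.defPt j j = u.pt j
  /-- In the other components it is smaller than `u`, ties being broken by the index. -/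
  defPt_lt : ∀ u ∈ S, ∀ j k, k ≠ j → TieLT l k (u.defPt j) (u.defPt k)
  /-- The side lengths of the boxes are nonnegative. -/
  lower_le_upper : ∀ u ∈ S, ∀ j, u.lower j ≤ u.upper zr j
  /-- The boxes of distinct local upper bounds are disjoint. -/
  disjoint : ∀ u ∈ S, ∀ v ∈ S, u ≠ v → Disjoint (u.box zr) (v.box zr)
  /-- Inside `{x | x < zr}` the boxes cover the dominated region and nothing else. -/
  cover : ∀ x, StrictlyDominates x zr →
    ((∃ u ∈ S, x ∈ u.box zr) ↔ x ∈ dominatedRegion zr {z | z ∈ l})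
  /-- The computed number is the exact hypervolume. -/
  volume_eq : boxVolumeSum zr S = hypervolume zr {z | z ∈ l}

end HBDA

namespace HBDA

variable {p : ℕ} {zr : Fin p → ℝ} {l M : List (Fin p → ℝ)} {a b c z : Fin p → ℝ} {j k : Fin p}

/-! Breaking ties by index puts the points in general position: `TieLT l k` is a strict order, total
on the points that may define component `k`, with the `k`-th dummy on top. In these orders the
stored items have a description independent of the algorithm, `IsTieUpperBound`: each defining point
precedes the others in every component but its own, and no inserted point precedes all of them. An
inserted point comes after all earlier ones, so ties resolve exactly as the real tests `<` and `≥`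
do; `mem_ubsI_iff` then shows by induction that the stored set consists of all such items. Sorting
by the last component makes the test omitted by HBDA-NI automatic. Everything else follows from the
description. If two boxes meet, `not_tieLT_of_mem_box` at the first differing defining point puts an
input point below a local upper bound. Existence, needed for covering and for `U(N)`, comes from a
greedy choice of defining points (`exists_isTieUpperBound`). The volume is then additivity over
disjoint boxes. -/

/-! ### The tie-broken orders. -/

theorem pair_sublist_trans {α : Type*} {l : List α} (hl : l.Nodup) {a b c : α}
    (hab : List.Sublist [a, b] l) (hbc : List.Sublist [b, c] l) : List.Sublist [a, c] l := by
  induction l with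
  | nil => simp at hab
  | cons x l ih =>
    rw [List.nodup_cons] at hl
    rcases List.sublist_cons_iff.1 hab with hab' | ⟨r, hr, hb⟩
    · rcases List.sublist_cons_iff.1 hbc with hbc | ⟨s, hs, hc⟩
      · exact (ih hl.2 hab' hbc).cons x
      · obtain ⟨rfl, rfl⟩ := List.cons.inj hs
        exact absurd (hab'.subset (List.mem_cons_of_mem a (List.mem_singleton_self b))) hl.1
    · obtain ⟨rfl, rfl⟩ := List.cons.inj hr
      rcases List.sublist_cons_iff.1 hbc with hbc | ⟨s, hs, hc⟩
      · exact List.Sublist.cons_cons _ (List.singleton_sublist.2 (hbc.subset (by simp)))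
      · obtain ⟨rfl, rfl⟩ := List.cons.inj hs
        exact absurd (hb.subset (List.mem_singleton_self b)) hl.1

theorem pair_sublist_total {α : Type*} {l : List α} {a b : α} (ha : a ∈ l) (hb : b ∈ l)
    (hab : a ≠ b) : List.Sublist [a, b] l ∨ List.Sublist [b, a] l := by
  induction l with
  | nil => simp at ha
  | cons x l ih =>
    rcases List.mem_cons.1 ha with rfl | ha'
    · have hb' := (List.mem_cons.1 hb).resolve_left hab.symm
      exact .inl (List.Sublist.cons_cons _ (List.singleton_sublist.2 hb'))
    · rcases List.mem_cons.1 hb with rfl | hb'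
      · exact .inr (List.Sublist.cons_cons _ (List.singleton_sublist.2 ha'))
      · exact (ih ha' hb').imp (·.cons x) (·.cons x)

theorem not_pair_sublist_self {α : Type*} {l : List α} (hl : l.Nodup) (a : α) :
    ¬ List.Sublist [a, a] l := List.nodup_iff_sublist.1 hl a

theorem TieLT.le (h : TieLT l j a b) : a j ≤ b j := h.elim le_of_lt fun h => h.1.le

theorem TieLT.trans (hl : l.Nodup) (hab : TieLT l j a b) (hbc : TieLT l j b c) :
    TieLT l j a c := by
  rcases hab with hab | ⟨hab, hab'⟩
  · exact .inl (hab.trans_le hbc.le)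
  · rcases hbc with hbc | ⟨hbc, hbc'⟩
    · exact .inl (hab.trans_lt hbc)
    · exact .inr ⟨hab.trans hbc, pair_sublist_trans hl hab' hbc'⟩

theorem not_tieLT_self (hl : l.Nodup) : ¬ TieLT l j a a := by
  rintro (h | ⟨-, h⟩)
  · exact lt_irrefl _ h
  · exact not_pair_sublist_self hl a h

@[simp] theorem dummy_self : dummy zr j j = zr j := by simp [dummy]

theorem dummy_of_ne (h : k ≠ j) : dummy zr j k = 0 := by simp [dummy, h]

/-- The points that may define the `j`-th component of a local upper bound. -/
def Candidate (zr : Fin p → ℝ) (l : List (Fin p → ℝ)) (j : Fin p) (a : Fin p → ℝ) : Prop :=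
  a ∈ l ∨ a = dummy zr j

theorem Candidate.mono (h : M ⊆ l) (ha : Candidate zr M j a) : Candidate zr l j a :=
  ha.imp_left fun h' => h h'

/-- The assumptions on the reference point and on the list of points. -/
structure Admissible (zr : Fin p → ℝ) (l : List (Fin p → ℝ)) : Prop where
  two_le : 2 ≤ p
  zr_pos : ∀ j, 0 < zr j
  nodup : l.Nodup
  bounds : ∀ z ∈ l, ∀ j, 0 < z j ∧ z j < zr j

theorem Admissible.dummy_notMem (h : Admissible zr l) : dummy zr j ∉ l := by
  intro hm
  have : Nontrivial (Fin p) := Fin.nontrivial_iff_two_le.2 h.two_le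
  obtain ⟨k, hk⟩ := exists_ne j
  have := (h.bounds _ hm k).1
  rw [dummy_of_ne hk] at this
  exact lt_irrefl _ this

theorem Admissible.candidate_pos (h : Admissible zr l) (ha : Candidate zr l j a) : 0 < a j := by
  rcases ha with ha | rfl
  · exact (h.bounds _ ha j).1
  · simpa using h.zr_pos j

theorem Admissible.candidate_le (h : Admissible zr l) (ha : Candidate zr l j a) : a j ≤ zr j := by
  rcases ha with ha | rfl
  · exact (h.bounds _ ha j).2.le
  · simp

theorem Admissible.dummy_tieLT (h : Admissible zr l) (hb : Candidate zr l k b) (hk : k ≠ j) :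
    TieLT l k (dummy zr j) b :=
  .inl (by rw [dummy_of_ne hk]; exact h.candidate_pos hb)

/-- The dummy attains the largest possible value `zr j`, and being outside the list it never wins a
tie. -/
theorem Admissible.not_dummy_tieLT (h : Admissible zr l) (hb : Candidate zr l j b) :
    ¬ TieLT l j (dummy zr j) b := by
  rintro (hlt | ⟨-, hs⟩)
  · rw [dummy_self] at hlt
    exact absurd hlt (h.candidate_le hb).not_gt
  · exact h.dummy_notMem (hs.subset List.mem_cons_self)

theorem Admissible.tieLT_dummy (h : Admissible zr l) (ha : a ∈ l) : TieLT l j a (dummy zr j) :=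
  .inl (by simpa using (h.bounds a ha j).2)

theorem Admissible.tieLT_total (h : Admissible zr l) (ha : Candidate zr l j a)
    (hb : Candidate zr l j b) (hab : a ≠ b) : TieLT l j a b ∨ TieLT l j b a := by
  rcases ha with ha | rfl
  · rcases hb with hb | rfl
    · rcases lt_trichotomy (a j) (b j) with hlt | heq | hlt
      · exact .inl (.inl hlt)
      · exact (pair_sublist_total ha hb hab).imp (fun hs => .inr ⟨heq, hs⟩)
          (fun hs => .inr ⟨heq.symm, hs⟩)
      · exact .inr (.inl hlt)
    · exact .inl (h.tieLT_dummy ha)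
  · rcases hb with hb | rfl
    · exact .inr (h.tieLT_dummy hb)
    · exact absurd rfl hab

/-- A transitive irreflexive relation on a finite set is well-founded; the dummy keeps the set
nonempty. -/
theorem Admissible.exists_minimal (h : Admissible zr l) (M : List (Fin p → ℝ))
    {Q : (Fin p → ℝ) → Prop} (hQ : Q (dummy zr j)) :
    ∃ a, Candidate zr M j a ∧ Q a ∧ ∀ b, Candidate zr M j b → Q b → ¬ TieLT l j b a := by
  let C : Set (Fin p → ℝ) := {a | Candidate zr M j a ∧ Q a}
  have hfin : C.Finite := by
    refine ((M.finite_toSet).union (Set.finite_singleton (dummy zr j))).subset ?_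
    rintro a ⟨ha | ha, -⟩
    · exact .inl ha
    · exact .inr ha
  have : Finite C := hfin
  let r : C → C → Prop := fun a b => TieLT l j a.1 b.1
  have : IsTrans C r := ⟨fun _ _ _ hab hbc => TieLT.trans h.nodup hab hbc⟩
  have : Std.Irrefl r := ⟨fun _ => not_tieLT_self h.nodup⟩
  have hwf : WellFounded r := Finite.wellFounded_of_trans_of_irrefl r
  obtain ⟨a, -, ha⟩ := hwf.has_min Set.univ ⟨⟨dummy zr j, .inr rfl, hQ⟩, trivial⟩
  exact ⟨a.1, a.2.1, a.2.2, fun b hb hb' => ha ⟨b, hb, hb'⟩ trivial⟩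

/-- The local upper bounds of the points of `M`, with respect to the orders `TieLT l`. -/
structure IsTieUpperBound (zr : Fin p → ℝ) (l M : List (Fin p → ℝ)) (u : LocalUpperBound p) :
    Prop where
  candidate : ∀ j, Candidate zr M j (u.defPt j)
  defPt_self : ∀ j, u.defPt j j = u.pt j
  defPt_lt : ∀ j k, k ≠ j → TieLT l k (u.defPt j) (u.defPt k)
  not_below : ∀ z ∈ M, ¬ ∀ j, TieLT l j z (u.defPt j)

theorem initial_isTieUpperBound (h : Admissible zr l) :
    IsTieUpperBound zr l [] (initial zr) where
  candidate _ := .inr rfl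
  defPt_self j := by simp [initial]
  defPt_lt j k hk := h.dummy_tieLT (.inr rfl) hk
  not_below := by simp

theorem IsTieUpperBound.eq_of_defPt_eq {u v : LocalUpperBound p} {M' : List (Fin p → ℝ)}
    (hu : IsTieUpperBound zr l M u) (hv : IsTieUpperBound zr l M' v) (h : u.defPt = v.defPt) :
    u = v := by
  refine LocalUpperBound.ext (funext fun j => ?_) h
  rw [← hu.defPt_self, ← hv.defPt_self, h]

theorem isTieUpperBound_nil_iff (h : Admissible zr l) {u : LocalUpperBound p} :
    IsTieUpperBound zr l [] u ↔ u = initial zr := by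
  refine ⟨fun hu => ?_, fun hu => hu ▸ initial_isTieUpperBound h⟩
  refine hu.eq_of_defPt_eq (initial_isTieUpperBound h) (funext fun j => ?_)
  simpa [Candidate, initial] using hu.candidate j

/-! ### One insertion. -/

section Insert

variable {l₁ l₂ : List (Fin p → ℝ)} {u : LocalUpperBound p}

/-- Ties favour the older point, hence the strict inequality here and the weak one in
`tieLT_new_right_iff`. -/
theorem Admissible.tieLT_new_iff (h : Admissible zr (l₁ ++ z :: l₂)) (ha : Candidate zr l₁ j a) :
    TieLT (l₁ ++ z :: l₂) k z a ↔ z k < a k := by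
  refine ⟨?_, .inl⟩
  rintro (hlt | ⟨-, hs⟩)
  · exact hlt
  · rcases ha with ha | rfl
    · have hs' : List.Sublist [a, z] (l₁ ++ z :: l₂) :=
        (List.singleton_sublist.2 ha).append (List.singleton_sublist.2 (by simp) : [z].Sublist _)
      exact absurd (pair_sublist_trans h.nodup hs hs') (not_pair_sublist_self h.nodup z)
    · exact absurd (hs.subset (List.mem_cons_of_mem z (List.mem_singleton_self _))) h.dummy_notMem

theorem Admissible.tieLT_new_right_iff (h : Admissible zr (l₁ ++ z :: l₂))
    (ha : Candidate zr l₁ j a) (hk : k ≠ j) :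
    TieLT (l₁ ++ z :: l₂) k a z ↔ a k ≤ z k := by
  refine ⟨TieLT.le, fun hle => ?_⟩
  rcases ha with ha | rfl
  · rcases hle.lt_or_eq with hlt | heq
    · exact .inl hlt
    · exact .inr ⟨heq, (List.singleton_sublist.2 ha).append
        (List.singleton_sublist.2 (by simp) : [z].Sublist _)⟩
  · exact .inl (by rw [dummy_of_ne hk]; exact (h.bounds z (by simp) k).1)

theorem IsTieUpperBound.strictlyDominates_iff (h : Admissible zr (l₁ ++ z :: l₂))
    (hu : IsTieUpperBound zr (l₁ ++ z :: l₂) l₁ u) :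
    StrictlyDominates z u.pt ↔ ∀ j, TieLT (l₁ ++ z :: l₂) j z (u.defPt j) :=
  forall_congr' fun j => by rw [h.tieLT_new_iff (hu.candidate j), hu.defPt_self]

theorem IsTieUpperBound.accepts_iff (h : Admissible zr (l₁ ++ z :: l₂))
    (hu : IsTieUpperBound zr (l₁ ++ z :: l₂) l₁ u) (j : Fin p) :
    Accepts z u j ↔ ∀ k, k ≠ j → TieLT (l₁ ++ z :: l₂) j (u.defPt k) z :=
  forall₂_congr fun k hk => (h.tieLT_new_right_iff (hu.candidate k) hk.symm).symm

theorem IsTieUpperBound.child (h : Admissible zr (l₁ ++ z :: l₂))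
    (hu : IsTieUpperBound zr (l₁ ++ z :: l₂) l₁ u) (hz : StrictlyDominates z u.pt)
    (hj : Accepts z u j) : IsTieUpperBound zr (l₁ ++ z :: l₂) (l₁ ++ [z]) (u.child z j) := by
  have hz' := (hu.strictlyDominates_iff h).1 hz
  have hj' := (hu.accepts_iff h j).1 hj
  have hother : ∀ k, k ≠ j → (u.child z j).defPt k = u.defPt k := fun k hk => by
    simp [LocalUpperBound.child, hk]
  have hself : (u.child z j).defPt j = z := by simp [LocalUpperBound.child]
  constructor
  · intro k
    by_cases hk : k = j
    · subst hk; exact .inl (by simp [hself])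
    · rw [hother k hk]; exact (hu.candidate k).mono (by simp)
  · intro k
    by_cases hk : k = j
    · subst hk; simp [LocalUpperBound.child]
    · rw [hother k hk, hu.defPt_self]; simp [LocalUpperBound.child, hk]
  · intro i k hik
    by_cases hi : i = j
    · subst hi; rw [hself, hother k hik]; exact hz' k
    · by_cases hk : k = j
      · subst hk; rw [hself, hother i hi]; exact hj' i hi
      · rw [hother i hi, hother k hk]; exact hu.defPt_lt i k hik
  · intro a ha hlt
    rcases List.mem_append.1 ha with ha | ha
    · refine hu.not_below a ha fun k => ?_
      by_cases hk : k = j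
      · subst hk
        have := hlt k
        rw [hself] at this
        exact this.trans h.nodup (hz' k)
      · rw [← hother k hk]; exact hlt k
    · obtain rfl := List.mem_singleton.1 ha
      have := hlt j
      rw [hself] at this
      exact not_tieLT_self h.nodup this

theorem IsTieUpperBound.keep (h : Admissible zr (l₁ ++ z :: l₂))
    (hu : IsTieUpperBound zr (l₁ ++ z :: l₂) l₁ u) (hz : ¬ StrictlyDominates z u.pt) :
    IsTieUpperBound zr (l₁ ++ z :: l₂) (l₁ ++ [z]) u where
  candidate j := (hu.candidate j).mono (by simp)
  defPt_self := hu.defPt_self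
  defPt_lt := hu.defPt_lt
  not_below a ha := by
    rcases List.mem_append.1 ha with ha | ha
    · exact hu.not_below a ha
    · obtain rfl := List.mem_singleton.1 ha
      rwa [← hu.strictlyDominates_iff h]

/-- This is completeness of the insertion: the parent is recovered by replacing `z` with the least
older candidate that precedes the other defining points of `w` in their components. Its minimality
is what leaves no point of `l₁` below the parent. -/
theorem IsTieUpperBound.exists_parent (h : Admissible zr (l₁ ++ z :: l₂))
    {w : LocalUpperBound p} (hw : IsTieUpperBound zr (l₁ ++ z :: l₂) (l₁ ++ [z]) w)
    (hj : w.defPt j = z) :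
    ∃ u, IsTieUpperBound zr (l₁ ++ z :: l₂) l₁ u ∧ StrictlyDominates z u.pt ∧ Accepts z u j ∧
      u.child z j = w := by
  have hsub : l₁ ++ [z] ⊆ l₁ ++ z :: l₂ := by
    intro a ha; simp only [List.mem_append, List.mem_cons] at ha ⊢; tauto
  have hsub₁ : l₁ ⊆ l₁ ++ z :: l₂ := by simp
  -- If `z` also defined component `k`, it would precede itself there.
  have hcand : ∀ k, k ≠ j → Candidate zr l₁ k (w.defPt k) := by
    intro k hk
    rcases hw.candidate k with hm | hm
    · rcases List.mem_append.1 hm with hm | hm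
      · exact .inl hm
      · have := hw.defPt_lt j k hk
        rw [hj, List.mem_singleton.1 hm] at this
        exact absurd this (not_tieLT_self h.nodup)
    · exact .inr hm
  obtain ⟨a, ha, hlt, hmin⟩ := h.exists_minimal (j := j) l₁
    (Q := fun a => ∀ k, k ≠ j → TieLT (l₁ ++ z :: l₂) k a (w.defPt k))
    (fun k hk => h.dummy_tieLT ((hw.candidate k).mono hsub) hk)
  -- Otherwise `a` would be an inserted point below `w`, or the dummy preceding `z`.
  have hza : TieLT (l₁ ++ z :: l₂) j z a := by
    have hne : z ≠ a := by
      rintro rfl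
      rcases ha with ha | ha
      · have := (List.nodup_append.1 h.nodup).2.2 z ha z (by simp)
        exact this rfl
      · exact h.dummy_notMem (l := l₁ ++ z :: l₂) (j := j) (ha ▸ by simp)
    refine (h.tieLT_total (.inl (by simp)) (ha.mono hsub₁) hne).resolve_right fun haz => ?_
    rcases ha with ha | rfl
    · refine hw.not_below a (by simp [ha]) fun k => ?_
      by_cases hk : k = j
      · subst hk; rwa [hj]
      · exact hlt k hk
    · exact h.not_dummy_tieLT (.inl (by simp)) haz
  let u : LocalUpperBound p := ⟨Function.update w.pt j (a j), Function.update w.defPt j a⟩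
  have hself : u.defPt j = a := by simp [u]
  have hother : ∀ k, k ≠ j → u.defPt k = w.defPt k := fun k hk => by simp [u, hk]
  have hu : IsTieUpperBound zr (l₁ ++ z :: l₂) l₁ u := by
    constructor
    · intro k
      by_cases hk : k = j
      · subst hk; rwa [hself]
      · rw [hother k hk]; exact hcand k hk
    · intro k
      by_cases hk : k = j
      · subst hk; simp [u]
      · rw [hother k hk, hw.defPt_self]; simp [u, hk]
    · intro i k hik
      by_cases hi : i = j
      · subst hi; rw [hself, hother k hik]; exact hlt k hik
      · by_cases hk : k = j
        · subst hk; rw [hself, hother i hi]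
          have := hw.defPt_lt i k hik
          rw [hj] at this
          exact this.trans h.nodup hza
        · rw [hother i hi, hother k hk]; exact hw.defPt_lt i k hik
    · intro b hb hlt'
      refine hmin b (.inl hb) (fun k hk => ?_) (hself ▸ hlt' j)
      rw [← hother k hk]; exact hlt' k
  refine ⟨u, hu, (hu.strictlyDominates_iff h).2 fun k => ?_, (hu.accepts_iff h j).2 fun k hk => ?_,
    LocalUpperBound.ext ?_ ?_⟩
  · by_cases hk : k = j
    · subst hk; rwa [hself]
    · rw [hother k hk]; have := hw.defPt_lt j k hk; rwa [hj] at this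
  · rw [hother k hk]; have := hw.defPt_lt k j hk.symm; rwa [hj] at this
  · simp only [LocalUpperBound.child, u, Function.update_idem]
    rw [← hj, hw.defPt_self, Function.update_eq_self]
  · simp only [LocalUpperBound.child, u, Function.update_idem]
    rw [← hj, Function.update_eq_self]

theorem mem_insertI {S : Finset (LocalUpperBound p)} :
    u ∈ insertI S z ↔ (∃ v ∈ S, StrictlyDominates z v.pt ∧ ∃ j, Accepts z v j ∧ v.child z j = u) ∨
      (u ∈ S ∧ ¬ StrictlyDominates z u.pt) := by
  classical
  simp only [insertI, Finset.mem_union, Finset.mem_image, Finset.mem_filter, Finset.mem_product,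
    Finset.mem_univ, and_true, Finset.mem_sdiff, Prod.exists]
  constructor
  · rintro (⟨v, j, ⟨⟨hv, hz⟩, hj⟩, rfl⟩ | ⟨hu, hz⟩)
    · exact .inl ⟨v, hv, hz, j, hj, rfl⟩
    · exact .inr ⟨hu, fun hz' => hz ⟨hu, hz'⟩⟩
  · rintro (⟨v, hv, hz, j, hj, rfl⟩ | ⟨hu, hz⟩)
    · exact .inl ⟨v, j, ⟨⟨hv, hz⟩, hj⟩, rfl⟩
    · exact .inr ⟨hu, fun hz' => hz hz'.2⟩

theorem insertNI_eq_insertI {S : Finset (LocalUpperBound p)}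
    (h : ∀ u ∈ S, ∀ j : Fin p, j.val + 1 = p → Accepts z u j) : insertNI S z = insertI S z := by
  classical
  simp only [insertNI, insertI]
  rw [← Finset.image_union, ← Finset.filter_or]
  congr 2
  refine Finset.filter_congr fun q hq => ?_
  have hS := (Finset.mem_filter.1 (Finset.mem_product.1 hq).1).1
  constructor
  · rintro (hlast | hq)
    · exact h _ hS _ hlast
    · exact hq.2
  · intro hacc
    rcases (Nat.succ_le_of_lt q.2.isLt).eq_or_lt with heq | hlt
    · exact .inl heq
    · exact .inr ⟨hlt, hacc⟩

theorem mem_insertI_iff_isTieUpperBound (h : Admissible zr (l₁ ++ z :: l₂))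
    {S : Finset (LocalUpperBound p)}
    (hS : ∀ v, v ∈ S ↔ IsTieUpperBound zr (l₁ ++ z :: l₂) l₁ v) :
    u ∈ insertI S z ↔ IsTieUpperBound zr (l₁ ++ z :: l₂) (l₁ ++ [z]) u := by
  rw [mem_insertI]
  constructor
  · rintro (⟨v, hv, hz, j, hj, rfl⟩ | ⟨hu, hz⟩)
    · exact ((hS v).1 hv).child h hz hj
    · exact ((hS u).1 hu).keep h hz
  · intro hu
    -- Items defined by `z` are children; the others were already local upper bounds of `l₁`.
    by_cases hex : ∃ j, u.defPt j = z
    · obtain ⟨j, hj⟩ := hex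
      obtain ⟨v, hv, hz, hacc, hch⟩ := hu.exists_parent h hj
      exact .inl ⟨v, (hS v).2 hv, hz, j, hacc, hch⟩
    · have hu' : IsTieUpperBound zr (l₁ ++ z :: l₂) l₁ u :=
        { candidate := fun j => by
            rcases hu.candidate j with hm | hm
            · rcases List.mem_append.1 hm with hm | hm
              · exact .inl hm
              · exact absurd ⟨j, List.mem_singleton.1 hm⟩ hex
            · exact .inr hm
          defPt_self := hu.defPt_self
          defPt_lt := hu.defPt_lt
          not_below := fun a ha => hu.not_below a (by simp [ha]) }
      refine .inr ⟨(hS u).2 hu', fun hz => hu.not_below z (by simp) ?_⟩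
      exact (hu'.strictlyDominates_iff h).1 hz

end Insert

/-! ### Complete runs of both algorithms. -/

/-- Ties are broken by the full list `l₁ ++ l₂`, so the orders stay fixed while the inserted prefix
grows. -/
theorem mem_ubsI_iff (l₁ l₂ : List (Fin p → ℝ)) (h : Admissible zr (l₁ ++ l₂))
    (u : LocalUpperBound p) :
    u ∈ ubsI zr l₁ ↔ IsTieUpperBound zr (l₁ ++ l₂) l₁ u := by
  induction l₁ using List.reverseRecOn generalizing l₂ u with
  | nil => rw [isTieUpperBound_nil_iff h]; simp [ubsI]
  | append_singleton l₁ z ih =>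
    rw [List.append_assoc, List.singleton_append] at h ⊢
    have : ubsI zr (l₁ ++ [z]) = insertI (ubsI zr l₁) z := by simp [ubsI]
    rw [this]
    exact mem_insertI_iff_isTieUpperBound h fun v => ih (z :: l₂) h v

theorem ubsNI_eq_ubsI (l₁ l₂ : List (Fin p → ℝ)) (h : Admissible zr (l₁ ++ l₂))
    (hsort : ∀ j : Fin p, j.val + 1 = p → (l₁ ++ l₂).Pairwise fun a b => a j ≤ b j) :
    ubsNI zr l₁ = ubsI zr l₁ := by
  induction l₁ using List.reverseRecOn generalizing l₂ with
  | nil => rfl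
  | append_singleton l₁ z ih =>
    rw [List.append_assoc, List.singleton_append] at h hsort
    have hI : ubsI zr (l₁ ++ [z]) = insertI (ubsI zr l₁) z := by simp [ubsI]
    have hNI : ubsNI zr (l₁ ++ [z]) = insertNI (ubsNI zr l₁) z := by simp [ubsNI]
    rw [hI, hNI, ih (z :: l₂) h hsort]
    refine insertNI_eq_insertI fun u hu j hj k hk => ?_
    rcases ((mem_ubsI_iff l₁ (z :: l₂) h u).1 hu).candidate k with hm | hm
    · exact (List.pairwise_append.1 (hsort j hj)).2.2 _ hm z (by simp)
    · rw [hm, dummy_of_ne hk.symm]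
      exact (h.bounds z (by simp) j).1.le

theorem testsAgree_ubsI (h : Admissible zr l) : TestsAgree (ubsI zr) l := by
  rintro l₁ z l₂ rfl u hu
  have hu' := (mem_ubsI_iff l₁ (z :: l₂) h u).1 hu
  exact ⟨hu'.strictlyDominates_iff h, hu'.accepts_iff h⟩

theorem testsAgree_ubsNI (h : Admissible zr l)
    (hsort : ∀ j : Fin p, j.val + 1 = p → l.Pairwise fun a b => a j ≤ b j) :
    TestsAgree (ubsNI zr) l := by
  rintro l₁ z l₂ rfl
  rw [ubsNI_eq_ubsI l₁ (z :: l₂) h hsort]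
  exact testsAgree_ubsI h l₁ z l₂ rfl

/-! ### Disjointness of the boxes. -/

section Boxes

variable {u v : LocalUpperBound p} {x : Fin p → ℝ}

theorem LocalUpperBound.lower_le_iff {j : Fin p} (hj : j.val ≠ 0) {c : ℝ} :
    u.lower j ≤ c ↔ ∀ k, k < j → u.defPt k j ≤ c := by
  rw [LocalUpperBound.lower, dif_neg hj]
  exact (Finset.sup'_le_iff _ _).trans (by simp)

theorem mem_box_iff : x ∈ u.box zr ↔ ∀ j : Fin p,
    (j.val = 0 → u.defPt j j ≤ x j ∧ x j ≤ zr j) ∧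
    (j.val ≠ 0 → (∀ k, k < j → u.defPt k j ≤ x j) ∧ x j < u.pt j) := by
  refine forall_congr' fun j => ?_
  by_cases hj : j.val = 0
  · simp [LocalUpperBound.lower, LocalUpperBound.upper, hj]
  · simp [LocalUpperBound.lower_le_iff hj, LocalUpperBound.upper, hj]

theorem IsTieUpperBound.pt_le (h : Admissible zr l) (hu : IsTieUpperBound zr l l u) (j : Fin p) :
    u.pt j ≤ zr j := by
  rw [← hu.defPt_self]
  exact h.candidate_le (hu.candidate j)

theorem IsTieUpperBound.pt_pos (h : Admissible zr l) (hu : IsTieUpperBound zr l l u) (j : Fin p) :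
    0 < u.pt j := by
  rw [← hu.defPt_self]
  exact h.candidate_pos (hu.candidate j)

theorem IsTieUpperBound.emptyBelow (hu : IsTieUpperBound zr l l u) :
    EmptyBelow {z | z ∈ l} u.pt := fun z hz hlt =>
  hu.not_below z hz fun j => .inl (by rw [hu.defPt_self]; exact hlt.2 j)

theorem IsTieUpperBound.lower_le_upper (h : Admissible zr l) (hu : IsTieUpperBound zr l l u)
    (j : Fin p) : u.lower j ≤ u.upper zr j := by
  by_cases hj : j.val = 0
  · simpa [LocalUpperBound.lower, LocalUpperBound.upper, hj] using h.candidate_le (hu.candidate j)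
  · rw [LocalUpperBound.lower_le_iff hj, LocalUpperBound.upper, if_neg hj]
    intro k hk
    rw [← hu.defPt_self]
    exact (hu.defPt_lt k j hk.ne').le

/-- Otherwise `u.defPt k` would lie below `v`: before `k` the defining points are shared, at `k`
this is the assumption, and after `k` the common point `x` separates the lower side of one box from
the upper side of the other. -/
theorem IsTieUpperBound.not_tieLT_of_mem_box (h : Admissible zr l)
    (hu : IsTieUpperBound zr l l u) (hv : IsTieUpperBound zr l l v) (hxu : x ∈ u.box zr)
    (hxv : x ∈ v.box zr) {k : Fin p} (hk : ∀ i, i < k → u.defPt i = v.defPt i) :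
    ¬ TieLT l k (u.defPt k) (v.defPt k) := by
  intro hlt
  rcases hu.candidate k with hm | hm
  · refine hv.not_below _ hm fun i => ?_
    rcases lt_trichotomy i k with hik | rfl | hik
    · rw [← hk i hik]
      exact hu.defPt_lt k i hik.ne
    · exact hlt
    · have hi : i.val ≠ 0 := (Nat.zero_le k.val |>.trans_lt hik).ne'
      refine .inl ?_
      rw [hv.defPt_self]
      exact (((mem_box_iff.1 hxu i).2 hi).1 k hik).trans_lt ((mem_box_iff.1 hxv i).2 hi).2
  · rw [hm] at hlt
    exact h.not_dummy_tieLT (hv.candidate k) hlt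

theorem IsTieUpperBound.eq_of_mem_box (h : Admissible zr l)
    (hu : IsTieUpperBound zr l l u) (hv : IsTieUpperBound zr l l v) (hxu : x ∈ u.box zr)
    (hxv : x ∈ v.box zr) : u = v := by
  refine hu.eq_of_defPt_eq hv (funext fun k => ?_)
  induction k using WellFoundedLT.induction with
  | ind k ih =>
    by_contra hne
    rcases h.tieLT_total (hu.candidate k) (hv.candidate k) hne with hlt | hlt
    · exact hu.not_tieLT_of_mem_box h hv hxu hxv ih hlt
    · exact hv.not_tieLT_of_mem_box h hu hxv hxu (fun i hi => (ih i hi).symm) hlt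

/-! ### Greedy construction of local upper bounds. -/

/-- The point `t k` is minimal, for the order `TieLT l k`, among the candidates for component `k`
that are smaller than `t i` in the components `i < k` and satisfy `P i` for `i > k`. -/
structure IsGreedyAt (zr : Fin p → ℝ) (l : List (Fin p → ℝ)) (P : Fin p → (Fin p → ℝ) → Prop)
    (t : Fin p → Fin p → ℝ) (k : Fin p) : Prop where
  candidate : Candidate zr l k (t k)
  tieLT : ∀ i, i < k → TieLT l i (t k) (t i)
  prop : ∀ i, k < i → P i (t k)
  minimal : ∀ b, Candidate zr l k b → (∀ i, i < k → TieLT l i b (t i)) → (∀ i, k < i → P i b) →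
    ¬ TieLT l k b (t k)

theorem IsGreedyAt.congr {P : Fin p → (Fin p → ℝ) → Prop} {t t' : Fin p → Fin p → ℝ} {k : Fin p}
    (ht : IsGreedyAt zr l P t k) (h : ∀ i, i ≤ k → t' i = t i) : IsGreedyAt zr l P t' k where
  candidate := by rw [h k le_rfl]; exact ht.candidate
  tieLT i hi := by rw [h k le_rfl, h i hi.le]; exact ht.tieLT i hi
  prop := by rw [h k le_rfl]; exact ht.prop
  minimal b hb hlt := by
    rw [h k le_rfl]
    exact ht.minimal b hb fun i hi => by rw [← h i hi.le]; exact hlt i hi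

theorem exists_isGreedyAt (h : Admissible zr l) {P : Fin p → (Fin p → ℝ) → Prop}
    (hd : ∀ i k, k ≠ i → P k (dummy zr i)) : ∃ t, ∀ k, IsGreedyAt zr l P t k := by
  have key : ∀ m ≤ p, ∃ t, ∀ k : Fin p, k.val < m → IsGreedyAt zr l P t k := by
    intro m
    induction m with
    | zero => exact fun _ => ⟨0, fun k hk => absurd hk (Nat.not_lt_zero _)⟩
    | succ m ih =>
      intro hm
      obtain ⟨t, ht⟩ := ih (by omega)
      obtain ⟨a, ha, ⟨ha₁, ha₂⟩, hmin⟩ := h.exists_minimal (j := ⟨m, hm⟩) l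
        (Q := fun a => (∀ i : Fin p, i < ⟨m, hm⟩ → TieLT l i a (t i)) ∧ ∀ i, ⟨m, hm⟩ < i → P i a)
        ⟨fun i hi => h.dummy_tieLT (ht i hi).candidate hi.ne, fun i hi => hd _ _ hi.ne'⟩
      have hne : ∀ i : Fin p, i < ⟨m, hm⟩ → Function.update t ⟨m, hm⟩ a i = t i :=
        fun i hi => Function.update_of_ne hi.ne _ _
      refine ⟨Function.update t ⟨m, hm⟩ a, fun k hk => ?_⟩
      rcases (Nat.lt_succ_iff.1 hk).lt_or_eq with hk' | hk'
      · exact (ht k hk').congr fun i hi => hne i (lt_of_le_of_lt hi hk')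
      · obtain rfl : k = ⟨m, hm⟩ := Fin.ext hk'
        constructor
        · simpa using ha
        · intro i hi; rw [hne i hi]; simpa using ha₁ i hi
        · simpa using ha₂
        · intro b hb hlt hP
          rw [Function.update_self]
          exact hmin b hb ⟨fun i hi => by rw [← hne i hi]; exact hlt i hi, hP⟩
  obtain ⟨t, ht⟩ := key p le_rfl
  exact ⟨t, fun k => ht k k.isLt⟩

/-- `P i` is an initial segment in component `i`, thought of as lying below a threshold there. The
greedy choice ensures the order conditions directly for `k < j`; for `k > j` they hold because `t j`
satisfies `P k` and `t k` does not. -/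
theorem exists_isTieUpperBound (h : Admissible zr l) {P : Fin p → (Fin p → ℝ) → Prop}
    (hP : ∀ i a b, P i a → ¬ P i b → TieLT l i a b) (hd : ∀ i k, P k (dummy zr i) ↔ k ≠ i) :
    ∃ u, IsTieUpperBound zr l l u ∧ (∀ k i, k < i → P i (u.defPt k)) ∧
      ∀ k : Fin p, k.val ≠ 0 → ¬ P k (u.defPt k) := by
  obtain ⟨t, ht⟩ := exists_isGreedyAt h fun i k => (hd i k).2
  have hnot : ∀ k : Fin p, k.val ≠ 0 → ¬ P k (t k) := by
    intro k hk hPk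
    have hmem : t k ∈ l := (ht k).candidate.resolve_right fun heq =>
      (hd k k).1 (heq ▸ hPk) rfl
    -- If `t k` satisfied `P k`, it would have been eligible one index earlier, and smaller than the
    -- choice made there.
    let k' : Fin p := ⟨k.val - 1, by omega⟩
    have hk' : k' < k := Fin.lt_def.2 (Nat.sub_one_lt hk)
    refine (ht k').minimal (t k) (.inl hmem) (fun i hi => (ht k).tieLT i (hi.trans hk'))
      (fun i hi => ?_) ((ht k).tieLT k' hk')
    have hki : k ≤ i := by
      have : k.val - 1 < i.val := hi
      exact Fin.le_def.2 (by omega)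
    rcases hki.eq_or_lt with rfl | hki
    · exact hPk
    · exact (ht k).prop i hki
  refine ⟨⟨fun j => t j j, t⟩, ⟨fun j => (ht j).candidate, fun _ => rfl, fun j k hkj => ?_,
    fun z hz hlt => ?_⟩, fun k => (ht k).prop, hnot⟩
  · rcases hkj.lt_or_gt with hkj | hkj
    · exact (ht j).tieLT k hkj
    · exact hP k _ _ ((ht j).prop k hkj) (hnot k (Nat.zero_le j.val |>.trans_lt hkj).ne')
  · have hp := h.two_le
    -- At the last index no `P` condition remains, so a point below all of `t` contradicts
    -- minimality.
    let e : Fin p := ⟨p - 1, by omega⟩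
    refine (ht e).minimal z (.inl hz) (fun i _ => hlt i) (fun i hi => ?_) (hlt e)
    have : p - 1 < i.val := hi
    omega

theorem exists_le_isTieUpperBound (h : Admissible zr l) (hx : x ∈ Set.Icc 0 zr)
    (hempty : EmptyBelow {z | z ∈ l} x) :
    ∃ u, IsTieUpperBound zr l l u ∧ ∀ j, x j ≤ u.pt j := by
  obtain ⟨u, hu, hlt, hnot⟩ := exists_isTieUpperBound h
    -- The alternative `a i ≤ 0` admits the dummies when `x i = 0`; positivity makes it void for
    -- input points.
    (P := fun i a => a i ≤ 0 ∨ a i < x i)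
    (fun i a b ha hb => by
      rw [not_or, not_le, not_lt] at hb
      exact .inl (ha.elim (fun ha => ha.trans_lt hb.1) fun ha => ha.trans_le hb.2))
    (fun i k => by
      constructor
      · rintro hP rfl
        rw [dummy_self] at hP
        exact hP.elim (h.zr_pos k).not_ge (hx.2 k).not_gt
      · intro hk
        exact .inl (dummy_of_ne hk).le)
  refine ⟨u, hu, fun j => ?_⟩
  rw [← hu.defPt_self]
  by_cases hj : j.val = 0
  · by_contra! hcon
    rcases hu.candidate j with hm | hm
    · refine hempty _ hm ⟨fun i => (h.bounds _ hm i).1.le, fun i => ?_⟩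
      by_cases hi : i = j
      · exact hi ▸ hcon
      · have hji : j < i := Fin.lt_def.2 (by
          have : i.val ≠ j.val := fun he => hi (Fin.ext he)
          omega)
        exact (hlt j i hji).resolve_left (h.bounds _ hm i).1.not_ge
    · rw [hm, dummy_self] at hcon
      exact (hx.2 j).not_gt hcon
  · exact not_lt.1 (not_or.1 (hnot j hj)).2

/-! ### Covering, upper bound set and hypervolume. -/

theorem exists_mem_box_iff (h : Admissible zr l) (hx : StrictlyDominates x zr) :
    (∃ u, IsTieUpperBound zr l l u ∧ x ∈ u.box zr) ↔ x ∈ dominatedRegion zr {z | z ∈ l} := by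
  have hp := h.two_le
  let o : Fin p := ⟨0, by omega⟩
  have hpos : ∀ j : Fin p, j ≠ o → j.val ≠ 0 := fun j hj he => hj (Fin.ext he)
  have hlt_o : ∀ j : Fin p, j ≠ o → o < j := fun j hj => Nat.pos_of_ne_zero (hpos j hj)
  constructor
  · rintro ⟨u, hu, hxu⟩
    -- The first defining point bounds the box from below in every component, so it witnesses
    -- membership in the dominated region.
    have hmem : u.defPt o ∈ l := (hu.candidate o).resolve_right fun heq => by
      have := ((mem_box_iff.1 hxu o).1 rfl).1
      rw [heq, dummy_self] at this
      exact (hx o).not_ge this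
    refine ⟨u.defPt o, hmem, fun j => ?_, fun j => (hx j).le⟩
    by_cases hj : j = o
    · rw [hj]; exact ((mem_box_iff.1 hxu o).1 rfl).1
    · exact ((mem_box_iff.1 hxu j).2 (hpos j hj)).1 o (hlt_o j hj)
  · rintro ⟨z, hz, hzx, -⟩
    have hz : z ∈ l := hz
    obtain ⟨u, hu, hle, hnot⟩ := exists_isTieUpperBound h (P := fun i a => a i ≤ x i)
      (fun i a b ha hb => .inl (ha.trans_lt (not_le.1 hb)))
      (fun i k => by
        constructor
        · rintro hP rfl
          rw [dummy_self] at hP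
          exact (hx k).not_ge hP
        · intro hk
          rw [dummy_of_ne hk]
          exact (h.bounds z hz k).1.le.trans (hzx k))
    have hlt : ∀ j : Fin p, j.val ≠ 0 → x j < u.pt j := fun j hj => by
      rw [← hu.defPt_self]; exact not_le.1 (hnot j hj)
    refine ⟨u, hu, mem_box_iff.2 fun j => ⟨fun hj => ⟨?_, (hx j).le⟩,
      fun hj => ⟨fun k hk => hle k j hk, hlt j hj⟩⟩⟩
    obtain rfl : j = o := Fin.ext hj
    -- If the box began above `x` in the first component, `z` would lie strictly below `u`.
    by_contra! hcon
    refine hu.not_below z hz fun i => ?_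
    by_cases hi : i = o
    · subst hi; exact .inl ((hzx _).trans_lt hcon)
    · exact .inl (by rw [hu.defPt_self]; exact (hzx i).trans_lt (hlt i (hpos i hi)))

/-- Stored vectors are empty below, and every vector of `[0, zr]` empty below lies under a stored
one, so both families have the same maximal elements. -/
theorem upperBoundSet_eq (h : Admissible zr l) {S : Finset (LocalUpperBound p)}
    (hS : ∀ u, u ∈ S ↔ IsTieUpperBound zr l l u) :
    upperBoundSet zr {z | z ∈ l} =
      {u | (∃ r ∈ S, r.pt = u) ∧ ∀ r ∈ S, ¬ Dominates u r.pt} := by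
  have hIcc : ∀ r ∈ S, r.pt ∈ Set.Icc 0 zr := fun r hr =>
    ⟨fun j => (((hS r).1 hr).pt_pos h j).le, ((hS r).1 hr).pt_le h⟩
  have hempty : ∀ r ∈ S, EmptyBelow {z | z ∈ l} r.pt := fun r hr => ((hS r).1 hr).emptyBelow
  ext x
  constructor
  · rintro ⟨hx, hxe, hmax⟩
    have hnot : ∀ r ∈ S, ¬ Dominates x r.pt := fun r hr hd => hmax _ (hIcc r hr) hd (hempty r hr)
    obtain ⟨u, hu, hle⟩ := exists_le_isTieUpperBound h hx hxe
    have hu := (hS u).2 hu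
    refine ⟨⟨u, hu, ?_⟩, hnot⟩
    by_contra hne
    exact hnot u hu ⟨hle, fun he => hne he.symm⟩
  · rintro ⟨⟨r, hr, rfl⟩, hnot⟩
    refine ⟨hIcc r hr, hempty r hr, fun v hv hd hve => ?_⟩
    obtain ⟨u, hu, hle⟩ := exists_le_isTieUpperBound h hv hve
    refine hnot u ((hS u).2 hu) ⟨fun j => (hd.1 j).trans (hle j), fun he => hd.2 ?_⟩
    exact funext fun j => le_antisymm (hd.1 j) (he ▸ hle j)

theorem LocalUpperBound.box_eq_pi (zr : Fin p → ℝ) (u : LocalUpperBound p) :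
    u.box zr = Set.univ.pi fun j : Fin p =>
      if j.val = 0 then Set.Icc (u.lower j) (u.upper zr j)
      else Set.Ico (u.lower j) (u.upper zr j) := by
  ext x
  rw [Set.mem_univ_pi]
  refine forall_congr' fun j => ?_
  split_ifs <;> simp

open MeasureTheory in
theorem volume_box (zr : Fin p → ℝ) (u : LocalUpperBound p) :
    volume (u.box zr) = ∏ j, ENNReal.ofReal (u.upper zr j - u.lower j) := by
  rw [u.box_eq_pi, volume_pi_pi]
  refine Finset.prod_congr rfl fun j _ => ?_
  split_ifs <;> simp

theorem measurableSet_box (zr : Fin p → ℝ) (u : LocalUpperBound p) :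
    MeasurableSet (u.box zr) := by
  rw [u.box_eq_pi]
  refine MeasurableSet.univ_pi fun j => ?_
  split_ifs
  · exact measurableSet_Icc
  · exact measurableSet_Ico

open MeasureTheory in
theorem boxVolumeSum_eq (h : Admissible zr l) {S : Finset (LocalUpperBound p)}
    (hS : ∀ u, u ∈ S ↔ IsTieUpperBound zr l l u) :
    boxVolumeSum zr S = hypervolume zr {z | z ∈ l} := by
  have hnonneg : ∀ u ∈ S, ∀ j, 0 ≤ u.upper zr j - u.lower j := fun u hu j =>
    sub_nonneg.2 (((hS u).1 hu).lower_le_upper h j)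
  have hae : dominatedRegion zr {z | z ∈ l} =ᵐ[volume] ⋃ u ∈ S, u.box zr := by
    -- The covering statement needs `x < zr`; the faces `x j = zr j` are null.
    have hnull : Set.univ.pi (fun j => Set.Iio (zr j)) =ᵐ[volume] Set.Iic zr :=
      Measure.univ_pi_Iio_ae_eq_Iic (μ := fun _ : Fin p => (volume : Measure ℝ))
    filter_upwards [hnull] with x hx
    have hiff : (∀ j, x j < zr j) ↔ x ≤ zr := by
      have hx' : x ∈ Set.univ.pi (fun j => Set.Iio (zr j)) ↔ x ∈ Set.Iic zr := hx.to_iff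
      simpa only [Set.mem_univ_pi, Set.mem_Iio, Set.mem_Iic] using hx'
    apply propext
    change x ∈ dominatedRegion zr {z | z ∈ l} ↔ x ∈ ⋃ u ∈ S, u.box zr
    simp only [Set.mem_iUnion, exists_prop, hS]
    constructor
    · intro hxD
      obtain ⟨z, hz, hzx, hxz⟩ := id hxD
      exact (exists_mem_box_iff h (hiff.2 hxz)).2 hxD
    · rintro ⟨u, hu, hxu⟩
      refine (exists_mem_box_iff h (hiff.2 fun j => ?_)).1 ⟨u, hu, hxu⟩
      by_cases hj : j.val = 0
      · exact ((mem_box_iff.1 hxu j).1 hj).2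
      · exact ((mem_box_iff.1 hxu j).2 hj).2.le.trans (hu.pt_le h j)
  have hdisj : (S : Set (LocalUpperBound p)).PairwiseDisjoint fun u => u.box zr := by
    intro u hu v hv huv
    refine Set.disjoint_left.2 fun x hxu hxv => huv ?_
    exact ((hS u).1 hu).eq_of_mem_box h ((hS v).1 hv) hxu hxv
  rw [hypervolume, measure_congr hae,
    measure_biUnion_finset hdisj fun u _ => measurableSet_box zr u, boxVolumeSum,
    ENNReal.toReal_sum fun u _ => by rw [volume_box]; exact ENNReal.prod_ne_top (by simp)]
  refine Finset.sum_congr rfl fun u hu => ?_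
  rw [volume_box, ENNReal.toReal_prod]
  exact Finset.prod_congr rfl fun j _ => (ENNReal.toReal_ofReal (hnonneg u hu j)).symm

theorem isValid_of_mem_iff (h : Admissible zr l) {S : Finset (LocalUpperBound p)}
    (hS : ∀ u, u ∈ S ↔ IsTieUpperBound zr l l u) : IsValid zr l S where
  maximal_eq := upperBoundSet_eq h hS
  defPt_mem u hu := ((hS u).1 hu).candidate
  defPt_self u hu := ((hS u).1 hu).defPt_self
  defPt_lt u hu := ((hS u).1 hu).defPt_lt
  lower_le_upper u hu := ((hS u).1 hu).lower_le_upper h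
  disjoint u hu v hv huv := Set.disjoint_left.2 fun _ hxu hxv =>
    huv (((hS u).1 hu).eq_of_mem_box h ((hS v).1 hv) hxu hxv)
  cover x hx := by simpa only [hS] using exists_mem_box_iff h hx
  volume_eq := boxVolumeSum_eq h hS

end Boxes

end HBDA

theorem mainTheorem1 (p : ℕ) (hp : 2 ≤ p) (zr : Fin p → ℝ) (hzr : ∀ j, 0 < zr j)
    (l : List (Fin p → ℝ)) (hnodup : l.Nodup)
    (hl : ∀ z ∈ l, ∀ j, 0 < z j ∧ z j < zr j)
    (hstable : HBDA.Stable {z | z ∈ l}) :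
    (HBDA.IsValid zr l (HBDA.ubsI zr l) ∧ HBDA.TestsAgree (HBDA.ubsI zr) l) ∧
    ((∀ j : Fin p, j.val + 1 = p → l.Pairwise fun a b => a j ≤ b j) →
      HBDA.IsValid zr l (HBDA.ubsNI zr l) ∧ HBDA.TestsAgree (HBDA.ubsNI zr) l) := by
  have h : HBDA.Admissible zr l := ⟨hp, hzr, hnodup, hl⟩
  have hvalid : HBDA.IsValid zr l (HBDA.ubsI zr l) :=
    HBDA.isValid_of_mem_iff h fun u => by
      simpa using HBDA.mem_ubsI_iff l [] (by simpa using h) u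
  refine ⟨⟨hvalid, HBDA.testsAgree_ubsI h⟩, fun hsort => ⟨?_, HBDA.testsAgree_ubsNI h hsort⟩⟩
  rw [HBDA.ubsNI_eq_ubsI l [] (by simpa using h) (by simpa using hsort)]
  exact hvalid
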